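/- **Setting.** Let $\mathcal N$ (buyers) and $\mathcal K$ (goods of unit supply) be finite sets. Buyer $n$ has a budget $B_n>0$, with $\sum_n B_n=1$, and a utility $U_n(\mathbf x_n,\mathbf x_{-n})$ that may depend on the whole allocation $\mathbf x=(x_{nk})\in\mathbb R_+^{\mathcal N\times\mathcal K}$. Assume that, at allocations with positive entries, $U_n\ge 0$, $U_n$ is concave and differentiable in $\mathbf x_n$, and $U_n$ is not saturated (for every $\mathbf x$ there is a positive bundle $\mathbf y$ with $U_n(\mathbf y,\mathbf x_{-n})>U_n(\mathbf x)$). Let $$\mathcal C=\Big\{\mathbf x\in\mathbb R_+^{\mathcal N\times\mathcal K}:\ \sum_n x_{nk}\le 1\ \ \forall k\Big\},\qquad F_{nk}(\mathbf x)=\frac{B_n\,\nabla_{nk}U_n(\mathbf x)}{\sum_{k'}\nabla_{nk'}U_n(\mathbf x)\,x_{nk'}},$$ where $\nabla_{nk}U_n$ is the $k$-th partial derivative in the own bundle $\mathbf x_n$ (taken within the orthant $\mathbb R^{\mathcal K}_+$), and let $D\subseteq\mathcal C$ be the set of feasible allocations at which $F$ is defined, i.e. at which every $U_n$ is differentiable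 in $\mathbf x_n$ within $\mathbb R^{\mathcal K}_+$ and no denominator vanishes. Assume that * $F$ is continuous, as a map $\mathcal C\to\mathbb R^{\mathcal N\times\mathcal K}\cup\{\infty\}$ with value $\infty$ off $D$: it is continuous on $D$, and $\|F(\mathbf y)\|\to\infty$ as $\mathbf y\to\mathbf x$, $\mathbf y\in D$, for every $\mathbf x\in\mathcal C\setminus D$; * $F$ is strictly monotone: $\langle F(\mathbf x)-F(\mathbf y),\mathbf x-\mathbf y\rangle<0$ for all distinct $\mathbf x,\mathbf y\in D$. A *variational equilibrium* of $\mathrm{VI}(\mathcal C,F)$ is a point $\mathbf x^*\in D$ with $\langle F(\mathbf x^*),\mathbf a-\mathbf x^*\rangle\le 0$ for all $\mathbf a\in\mathcal C$. **Algorithm (trading post).** Let $\alpha_t\ge 0$ with $\alpha_t\to 0$ and $\sum_t\alpha_t=\infty$. From initial bids $b_{nk}(0)$ put, for $t=0,1,2,\dots$, $$p_k(t)=\sum_n b_{nk}(t),\qquad x_{nk}(t)=\frac{b_{nk}(t)}{p_k(t)},\qquad b_{nk}(t+1)=b_{nk}(t)+\alpha_t\,b_{nk}(t)\big(F_{nk}(\mathbf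 x(t))-p_k(t)\big).$$ **Theorem 5.** There is exactly one variational equilibrium $\mathbf x^*$ of $\mathrm{VI}(\mathcal C,F)$, and $\mathbf x(t)\to\mathbf x^*$ for every run of the algorithm whose bids remain positive. The bids do remain positive whenever the initial bids are positive and $\alpha_t\max\{1,p_k(0)\}<1$ for all $t$ and $k$. -/

import Mathlib

/-- Data of a generalized Fisher market with buyers `N` and goods `K`: budgets, normalised to total
mass one, and utilities, which may depend on the whole allocation `x : N → K → ℝ`. Every good has
unit supply. -/
structure FisherMarket (N K : Type*) [Fintype N] where
  budget : N → ℝ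
  utility : N → (N → K → ℝ) → ℝ
  budget_pos : ∀ n, 0 < budget n
  budget_sum : ∑ n, budget n = 1

namespace FisherMarket

variable {N K : Type*} [Fintype N] [Fintype K] [DecidableEq N] [DecidableEq K]

/-- The utility of buyer `n` as a function of the bundle `y` of that buyer, the bundles of the other
buyers being those of `x`. -/
def ownUtility (M : FisherMarket N K) (n : N) (x : N → K → ℝ) : (K → ℝ) → ℝ :=
  fun y => M.utility n (Function.update x n y)

/-- Allocations with strictly positive entries. -/
def IsPositive (x : N → K → ℝ) : Prop := ∀ n k, 0 < x n k

/-- The standing assumptions on the utilities, at positive allocations: values in `ℝ₊`, concavity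
in the own bundle, no saturation, and differentiability in the own bundle. -/
structure RegularUtilities (M : FisherMarket N K) : Prop where
  nonneg : ∀ n x, IsPositive x → 0 ≤ M.utility n x
  concave : ∀ n x, IsPositive x → ConcaveOn ℝ {y | ∀ k, 0 < y k} (M.ownUtility n x)
  no_saturation : ∀ n x, IsPositive x →
    ∃ y : K → ℝ, (∀ k, 0 < y k) ∧ M.utility n x < M.ownUtility n x y
  differentiable : ∀ n x, IsPositive x → DifferentiableAt ℝ (M.ownUtility n x) (x n)

/-- The feasible set `C`: nonnegative allocations within the unit supply of every good. -/
def feasible (N K : Type*) [Fintype N] : Set (N → K → ℝ) :=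
  {x | (∀ n k, 0 ≤ x n k) ∧ ∀ k, ∑ n, x n k ≤ 1}

/-- The marginal utility `∇_{nk} U_n (x)`. The derivative is taken within the nonnegative orthant,
so it is the usual partial derivative when the bundle of `n` is positive, and one-sided in the
directions in which that bundle is on the boundary. -/
noncomputable def marginal (M : FisherMarket N K) (x : N → K → ℝ) (n : N) (k : K) : ℝ :=
  fderivWithin ℝ (M.ownUtility n x) (Set.Ici 0) (x n) (Pi.single k 1)

/-- `F_{nk}(x) = B_n ∇_{nk} U_n(x) / ∑_{k'} ∇_{nk'} U_n(x) x_{nk'}`. -/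
noncomputable def F (M : FisherMarket N K) (x : N → K → ℝ) (n : N) (k : K) : ℝ :=
  M.budget n * M.marginal x n k / ∑ k', M.marginal x n k' * x n k'

/-- The feasible allocations at which the formula for `F` makes sense: the own-bundle gradients
exist and no denominator vanishes. (It never makes sense where some buyer receives nothing.) -/
def domF (M : FisherMarket N K) : Set (N → K → ℝ) :=
  {x | x ∈ feasible N K ∧
    ∀ n, DifferentiableWithinAt ℝ (M.ownUtility n x) (Set.Ici 0) (x n) ∧
      ∑ k, M.marginal x n k * x n k ≠ 0}

/-- `⟨u, v⟩` on `ℝ^{NK}`. -/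
def pairing (u v : N → K → ℝ) : ℝ := ∑ n, ∑ k, u n k * v n k

/-- `F` is continuous on the feasible set, as a map to `ℝ^{NK} ∪ {∞}` with value `∞` at the
singular points: it is continuous where it is defined and its norm tends to infinity at the
feasible points where it is not. -/
def ContinuousF (M : FisherMarket N K) : Prop :=
  ContinuousOn M.F M.domF ∧
    ∀ x ∈ feasible N K, x ∉ M.domF →
      Filter.Tendsto (fun y => ‖M.F y‖) (nhdsWithin x M.domF) Filter.atTop

/-- Strict monotonicity of `F`, with the sign convention of maximisation. -/
def StrictlyMonotoneF (M : FisherMarket N K) : Prop :=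
  ∀ x ∈ M.domF, ∀ y ∈ M.domF, x ≠ y → pairing (M.F x - M.F y) (x - y) < 0

/-- Variational equilibria, i.e. solutions of `VI(C, F)`. -/
def IsVariationalEquilibrium (M : FisherMarket N K) (x : N → K → ℝ) : Prop :=
  x ∈ M.domF ∧ ∀ a ∈ feasible N K, pairing (M.F x) (a - x) ≤ 0

/-- Trading post: the price of a good is the sum of the bids on it. -/
def price (b : N → K → ℝ) (k : K) : ℝ := ∑ n, b n k

/-- Trading post: every good is shared in proportion to the bids on it. -/
noncomputable def allocation (b : N → K → ℝ) (n : N) (k : K) : ℝ := b n k / price b k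

/-- The bids produced by the trading-post learning algorithm with step sizes `α` from the initial
bids `b₀`. -/
noncomputable def bids (M : FisherMarket N K) (α : ℕ → ℝ) (b₀ : N → K → ℝ) : ℕ → N → K → ℝ
  | 0 => b₀
  | t + 1 => fun n k =>
      bids M α b₀ t n k + α t * bids M α b₀ t n k *
        (M.F (allocation (bids M α b₀ t)) n k - price (bids M α b₀ t) k)

end FisherMarket

set_option linter.unusedSectionVars false

/-! Everything rests on the identity ⟨F(y), y⟩ = 1 (`pairing_F_self`). It turns the variational
inequality into ⟨F(x), a⟩ ≤ 1 for feasible a, and its Minty form into 1 ≤ ⟨F(y), x⟩ for positive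
feasible y.

Existence: the Minty inequalities are linear in x. Monotonicity makes any finite family of them
solvable by a theorem of the alternative, and compactness gives a common solution. The blow-up of F
keeps that solution inside `domF`, and continuity along segments turns it into an equilibrium.
Strict monotonicity gives uniqueness and, by compactness of a small sphere, a uniform gap 1 + c ≤
⟨F(y), x⟩ away from x (`exists_gap`).

Convergence: the divergence from the equilibrium z is a Lyapunov function. In one step it changes by
at most -α(⟨F, z⟩ - 1) + O(α²), once ⟨F, z⟩ is replaced by a truncated version; truncation is needed
because F may be unbounded along the run (`divergence_bids_succ_le`). With the gap,
`tendsto_zero_of_drift` applies. -/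

/-! ### Concave functions and a theorem of the alternative. -/

theorem ConcaveOn.le_add_fderiv {E : Type*} [NormedAddCommGroup E] [NormedSpace ℝ E]
    {s : Set E} {f : E → ℝ} (hf : ConcaveOn ℝ s f) {x y : E} (hx : x ∈ s) (hy : y ∈ s)
    (hd : DifferentiableAt ℝ f x) : f y ≤ f x + fderiv ℝ f x (y - x) := by
  have hg : ConcaveOn ℝ (AffineMap.lineMap x y ⁻¹' s) (f ∘ AffineMap.lineMap (k := ℝ) x y) :=
    hf.comp_affineMap _
  have hd' : HasFDerivAt f (fderiv ℝ f x) (AffineMap.lineMap (k := ℝ) x y 0) := by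
    simpa using hd.hasFDerivAt
  have hder : HasDerivAt (f ∘ AffineMap.lineMap (k := ℝ) x y) (fderiv ℝ f x (y - x)) 0 :=
    hd'.comp_hasDerivAt 0 AffineMap.hasDerivAt_lineMap
  have := hg.slope_le_of_hasDerivAt (x := 0) (y := 1) (by simpa using hx) (by simpa using hy)
    one_pos hder
  simp only [slope_def_field, Function.comp_apply, AffineMap.lineMap_apply_one,
    AffineMap.lineMap_apply_zero, sub_zero, div_one] at this
  linarith

theorem ConcaveOn.fderiv_nonneg_of_bddBelow {E : Type*} [NormedAddCommGroup E] [NormedSpace ℝ E]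
    {s : Set E} {f : E → ℝ} (hf : ConcaveOn ℝ s f) {x v : E} (hx : x ∈ s)
    (hd : DifferentiableAt ℝ f x) (hv : ∀ r : ℝ, 0 ≤ r → x + r • v ∈ s)
    (hpos : ∀ y ∈ s, 0 ≤ f y) : 0 ≤ fderiv ℝ f x v := by
  by_contra! h
  obtain ⟨r, hr0, hr⟩ : ∃ r : ℝ, 0 ≤ r ∧ f x + r * fderiv ℝ f x v < 0 := by
    -- At this r the tangent line takes the value -1.
    refine ⟨(f x + 1) / (-fderiv ℝ f x v), ?_, ?_⟩
    · have := hpos x hx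
      exact div_nonneg (by linarith) (by linarith)
    · rw [div_mul_eq_mul_div, mul_div_assoc, div_neg, div_self h.ne]
      linarith
  have h1 := hf.le_add_fderiv hx (hv r hr0) hd
  have h2 := hpos _ (hv r hr0)
  simp at h1
  linarith

/-- A square matrix `A` such that `A + Aᵀ` has nonnegative entries maps some point of the simplex
to a nonnegative vector. -/
theorem exists_stdSimplex_mulVec_nonneg {ι : Type*} [Fintype ι] [Nonempty ι] (A : Matrix ι ι ℝ)
    (hA : ∀ i j, 0 ≤ A i j + A j i) : ∃ w ∈ stdSimplex ℝ ι, ∀ i, 0 ≤ A.mulVec w i := by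
  classical
  by_contra! hcon
  have hdisj : Disjoint (A.mulVecLin '' stdSimplex ℝ ι) (Set.Ici (0 : ι → ℝ)) := by
    rw [Set.disjoint_left]
    rintro _ ⟨w, hw, rfl⟩ h0
    obtain ⟨i, hi⟩ := hcon w hw
    exact absurd (h0 i) (by simpa using hi)
  -- The separating functional has coefficients m ≥ 0 and is negative on A(simplex). Normalising m
  -- to a simplex point gives mᵀAm < 0, whereas 2mᵀAm = mᵀ(A + Aᵀ)m ≥ 0.
  obtain ⟨f, u, v, hfu, huv, hfv⟩ := geometric_hahn_banach_compact_closed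
    ((convex_stdSimplex ℝ ι).linear_image A.mulVecLin)
    ((isCompact_stdSimplex ℝ ι).image (LinearMap.continuous_of_finiteDimensional _))
    (convex_Ici (0 : ι → ℝ)) isClosed_Ici hdisj
  set m : ι → ℝ := fun i => f (Pi.single i 1) with hm
  have hf : ∀ w : ι → ℝ, f w = ∑ i, w i * m i := fun w => by
    conv_lhs => rw [pi_eq_sum_univ' w]
    simp [hm]
  have hv0 : v < 0 := by simpa using hfv 0 (by simp)
  have hm0 : ∀ i, 0 ≤ m i := by
    intro i
    by_contra! hi
    have h := hfv ((v / m i) • Pi.single i 1) (by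
      intro j
      have h1 : 0 ≤ v / m i := (div_pos_of_neg_of_neg hv0 hi).le
      by_cases hj : j = i
      · subst hj; simpa using h1
      · simp [hj])
    rw [map_smul, smul_eq_mul, show f (Pi.single i 1) = m i from rfl, div_mul_cancel₀ _ hi.ne] at h
    exact lt_irrefl _ h
  have hquad : 0 ≤ ∑ i, A.mulVec m i * m i := by
    have h1 : ∑ i, A.mulVec m i * m i = ∑ i, ∑ j, A i j * m j * m i := by
      simp [Matrix.mulVec, dotProduct, Finset.sum_mul]
    have h2 : ∑ i, A.mulVec m i * m i = ∑ i, ∑ j, A j i * m j * m i := by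
      rw [h1, Finset.sum_comm]
      exact Finset.sum_congr rfl fun i _ => Finset.sum_congr rfl fun j _ => by ring
    have h3 : 0 ≤ ∑ i, ∑ j, (A i j + A j i) * (m j * m i) :=
      Finset.sum_nonneg fun i _ => Finset.sum_nonneg fun j _ =>
        mul_nonneg (hA i j) (mul_nonneg (hm0 j) (hm0 i))
    have h4 : ∑ i, ∑ j, (A i j + A j i) * (m j * m i)
        = ∑ i, ∑ j, A i j * m j * m i + ∑ i, ∑ j, A j i * m j * m i := by
      simp only [← Finset.sum_add_distrib]
      exact Finset.sum_congr rfl fun i _ => Finset.sum_congr rfl fun j _ => by ring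
    linarith
  have hsum : 0 < ∑ i, m i := by
    refine (Finset.sum_nonneg fun i _ => hm0 i).lt_of_ne fun h0 => ?_
    have hz : ∀ i, m i = 0 := fun i =>
      (Finset.sum_eq_zero_iff_of_nonneg fun i _ => hm0 i).1 h0.symm i (Finset.mem_univ i)
    obtain ⟨i⟩ := ‹Nonempty ι›
    have h := hfu _ ⟨Pi.single i 1, single_mem_stdSimplex ℝ i, rfl⟩
    rw [hf] at h
    simp only [hz, mul_zero, Finset.sum_const_zero] at h
    linarith
  have hw : (∑ i, m i)⁻¹ • m ∈ stdSimplex ℝ ι :=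
    ⟨fun i => mul_nonneg (inv_nonneg.2 hsum.le) (hm0 i), by
      simp [← Finset.mul_sum, hsum.ne']⟩
  have h := hfu _ ⟨_, hw, rfl⟩
  rw [map_smul, map_smul, smul_eq_mul, hf, Matrix.mulVecLin_apply] at h
  have := mul_nonneg (inv_nonneg.2 hsum.le) hquad
  linarith

/-! ### The feasible set and the sign of F. -/

namespace FisherMarket

variable {N K : Type*} [Fintype N] [Fintype K]

theorem pairing_add_right (u v w : N → K → ℝ) :
    pairing u (v + w) = pairing u v + pairing u w := by
  simp [pairing, mul_add, Finset.sum_add_distrib]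

theorem pairing_sub_right (u v w : N → K → ℝ) :
    pairing u (v - w) = pairing u v - pairing u w := by
  simp [pairing, mul_sub, Finset.sum_sub_distrib]

theorem pairing_sub_left (u v w : N → K → ℝ) :
    pairing (u - v) w = pairing u w - pairing v w := by
  simp [pairing, sub_mul, Finset.sum_sub_distrib]

theorem pairing_smul_right (u v : N → K → ℝ) (c : ℝ) :
    pairing u (c • v) = c * pairing u v := by
  simp only [pairing, Finset.mul_sum, Pi.smul_apply, smul_eq_mul]
  exact Finset.sum_congr rfl fun n _ => Finset.sum_congr rfl fun k _ => by ring

theorem pairing_sum_right {ι : Type*} (s : Finset ι) (u : N → K → ℝ) (v : ι → N → K → ℝ) :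
    pairing u (∑ i ∈ s, v i) = ∑ i ∈ s, pairing u (v i) := by
  classical
  induction s using Finset.induction_on with
  | empty => simp [pairing]
  | insert a s ha ih => rw [Finset.sum_insert ha, Finset.sum_insert ha, pairing_add_right, ih]

theorem pairing_mono_right {u v w : N → K → ℝ} (hu : ∀ n k, 0 ≤ u n k) (h : ∀ n k, v n k ≤ w n k) :
    pairing u v ≤ pairing u w :=
  Finset.sum_le_sum fun n _ => Finset.sum_le_sum fun k _ =>
    mul_le_mul_of_nonneg_left (h n k) (hu n k)

theorem continuous_pairing :
    Continuous fun p : (N → K → ℝ) × (N → K → ℝ) => pairing p.1 p.2 := by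
  unfold pairing
  fun_prop

theorem convex_feasible : Convex ℝ (feasible N K) := by
  intro x hx y hy a b ha hb hab
  refine ⟨fun n k => ?_, fun k => ?_⟩
  · have h1 := mul_nonneg ha (hx.1 n k)
    have h2 := mul_nonneg hb (hy.1 n k)
    simpa using add_nonneg h1 h2
  · have h1 := mul_le_mul_of_nonneg_left (hx.2 k) ha
    have h2 := mul_le_mul_of_nonneg_left (hy.2 k) hb
    simp only [Pi.add_apply, Pi.smul_apply, smul_eq_mul, Finset.sum_add_distrib, ← Finset.mul_sum]
    linarith

theorem isCompact_feasible : IsCompact (feasible N K) := by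
  have hclosed : IsClosed (feasible N K) := by
    have : feasible N K = (⋂ n, ⋂ k, {x | 0 ≤ x n k}) ∩ ⋂ k, {x | ∑ n, x n k ≤ 1} := by
      ext x; simp [feasible]
    rw [this]
    refine (isClosed_iInter fun n => isClosed_iInter fun k => ?_).inter (isClosed_iInter fun k => ?_)
    · exact isClosed_le (by fun_prop) (by fun_prop)
    · exact isClosed_le (by fun_prop) (by fun_prop)
  refine (isCompact_Icc (a := (0 : N → K → ℝ)) (b := 1)).of_isClosed_subset hclosed ?_
  exact fun x hx => ⟨fun n k => hx.1 n k, fun n k =>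
    (Finset.single_le_sum (f := fun n => x n k) (fun m _ => hx.1 m k) (Finset.mem_univ n)).trans
      (hx.2 k)⟩

variable [DecidableEq N] [DecidableEq K] {M : FisherMarket N K}

theorem nonempty_buyers (M : FisherMarket N K) : Nonempty N := by
  by_contra h
  rw [not_nonempty_iff] at h
  simpa using M.budget_sum

theorem ownUtility_self (n : N) (x : N → K → ℝ) : M.ownUtility n x (x n) = M.utility n x := by
  simp [ownUtility]

theorem ownUtility_nonneg (hU : M.RegularUtilities) {x : N → K → ℝ} (hx : IsPositive x)
    (n : N) {y : K → ℝ} (hy : ∀ k, 0 < y k) : 0 ≤ M.ownUtility n x y := by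
  refine hU.nonneg n _ fun m k => ?_
  by_cases h : m = n
  · subst h; simpa using hy k
  · simpa [h] using hx m k

theorem marginal_eq_fderiv {x : N → K → ℝ} (hx : IsPositive x) (n : N) (k : K) :
    M.marginal x n k = fderiv ℝ (M.ownUtility n x) (x n) (Pi.single k 1) := by
  rw [marginal, fderivWithin_of_mem_nhds]
  have : {y : K → ℝ | ∀ k, 0 < y k} ∈ nhds (x n) := by
    refine IsOpen.mem_nhds ?_ fun k => hx n k
    simp only [Set.ofPred_forall]
    exact isOpen_iInter_of_finite fun k => isOpen_lt continuous_const (continuous_apply k)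
  filter_upwards [this] with y hy k using (hy k).le

theorem fderiv_eq_sum_marginal {x : N → K → ℝ} (hx : IsPositive x) (n : N) (v : K → ℝ) :
    fderiv ℝ (M.ownUtility n x) (x n) v = ∑ k, M.marginal x n k * v k := by
  conv_lhs => rw [pi_eq_sum_univ' v]
  simp [marginal_eq_fderiv hx, mul_comm]

theorem marginal_nonneg (hU : M.RegularUtilities) {x : N → K → ℝ} (hx : IsPositive x)
    (n : N) (k : K) : 0 ≤ M.marginal x n k := by
  rw [marginal_eq_fderiv hx]
  refine (hU.concave n x hx).fderiv_nonneg_of_bddBelow (hx n) (hU.differentiable n x hx)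
    (fun r hr j => ?_) fun y hy => ownUtility_nonneg hU hx n hy
  have : 0 ≤ (Pi.single k 1 : K → ℝ) j := by
    by_cases h : j = k
    · subst h; simp
    · simp [h]
  have := mul_nonneg hr this
  have := hx n j
  simp only [Pi.add_apply, Pi.smul_apply, smul_eq_mul]
  linarith

/-- If the sum of these nonnegative terms vanished, so would the gradient; by concavity the bundle
would then be optimal, against non-saturation. -/
theorem sum_marginal_mul_pos (hU : M.RegularUtilities) {x : N → K → ℝ} (hx : IsPositive x)
    (n : N) : 0 < ∑ k, M.marginal x n k * x n k := by
  have hnn : ∀ k ∈ Finset.univ, 0 ≤ M.marginal x n k * x n k := fun k _ =>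
    mul_nonneg (marginal_nonneg hU hx n k) (hx n k).le
  refine (Finset.sum_nonneg hnn).lt_of_ne fun h0 => ?_
  have hz : ∀ k, M.marginal x n k = 0 := fun k =>
    (mul_eq_zero.1 ((Finset.sum_eq_zero_iff_of_nonneg hnn).1 h0.symm k (Finset.mem_univ k))).resolve_right
      (hx n k).ne'
  obtain ⟨y, hy, hlt⟩ := hU.no_saturation n x hx
  have := (hU.concave n x hx).le_add_fderiv (hx n) hy (hU.differentiable n x hx)
  rw [fderiv_eq_sum_marginal hx, ownUtility_self] at this
  simp only [hz, zero_mul, Finset.sum_const_zero] at this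
  linarith

theorem IsPositive.mem_domF (hU : M.RegularUtilities) {x : N → K → ℝ} (hx : IsPositive x)
    (hf : x ∈ feasible N K) : x ∈ M.domF :=
  ⟨hf, fun n => ⟨(hU.differentiable n x hx).differentiableWithinAt,
    (sum_marginal_mul_pos hU hx n).ne'⟩⟩

theorem F_nonneg (hU : M.RegularUtilities) {x : N → K → ℝ} (hx : IsPositive x)
    (n : N) (k : K) : 0 ≤ M.F x n k :=
  div_nonneg (mul_nonneg (M.budget_pos n).le (marginal_nonneg hU hx n k))
    (sum_marginal_mul_pos hU hx n).le

theorem sum_F_mul {x : N → K → ℝ} (hx : x ∈ M.domF) (n : N) :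
    ∑ k, M.F x n k * x n k = M.budget n := by
  have h := (hx.2 n).2
  simp only [F, div_mul_eq_mul_div, mul_assoc, ← Finset.sum_div, ← Finset.mul_sum]
  field_simp

theorem pairing_F_self {x : N → K → ℝ} (hx : x ∈ M.domF) : pairing (M.F x) x = 1 := by
  simp only [pairing, sum_F_mul hx, M.budget_sum]

end FisherMarket

/-! ### Existence, uniqueness and strictness of the equilibrium. -/

namespace FisherMarket

variable {N K : Type*} [Fintype N] [Fintype K] [DecidableEq N] [DecidableEq K]
  {M : FisherMarket N K}

/-- The allocation that shares every good equally among the buyers. -/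
noncomputable def equalShares (N K : Type*) [Fintype N] : N → K → ℝ :=
  fun _ _ => (Fintype.card N : ℝ)⁻¹

theorem equalShares_pos [Nonempty N] : IsPositive (equalShares N K) := fun _ _ => by
  have : (0 : ℝ) < Fintype.card N := by exact_mod_cast Fintype.card_pos
  simpa [equalShares] using this

theorem equalShares_mem_feasible [Nonempty N] : equalShares N K ∈ feasible N K :=
  ⟨fun n k => (equalShares_pos n k).le, fun k => by simp [equalShares]⟩

theorem isPositive_add_smul_sub {x a : N → K → ℝ} (hx : x ∈ feasible N K) (ha : IsPositive a)
    {r : ℝ} (hr0 : 0 < r) (hr1 : r ≤ 1) : IsPositive (x + r • (a - x)) := fun n k => by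
  have h1 := mul_nonneg (sub_nonneg.2 hr1) (hx.1 n k)
  have h2 := mul_pos hr0 (ha n k)
  simp only [Pi.add_apply, Pi.smul_apply, Pi.sub_apply, smul_eq_mul]
  linarith

theorem tendsto_add_smul_sub (x a : N → K → ℝ) :
    Filter.Tendsto (fun r : ℝ => x + r • (a - x)) (nhdsWithin 0 (Set.Ioi 0)) (nhds x) := by
  have : Continuous fun r : ℝ => x + r • (a - x) := by fun_prop
  have h := this.tendsto 0
  simp only [zero_smul, add_zero] at h
  exact h.mono_left nhdsWithin_le_nhds

/-- The bound 1/2 on r gives x ≤ 2(x + r(a - x)) entrywise, as used in `IsMintySolution.mem_domF`.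
-/
theorem eventually_add_smul_sub {x a : N → K → ℝ} (hx : x ∈ feasible N K) (ha : IsPositive a)
    (haf : a ∈ feasible N K) : ∀ᶠ r : ℝ in nhdsWithin 0 (Set.Ioi 0),
      0 < r ∧ r < 1 / 2 ∧ IsPositive (x + r • (a - x)) ∧ x + r • (a - x) ∈ feasible N K := by
  have : Set.Ioo (0 : ℝ) (1 / 2) ∈ nhdsWithin (0 : ℝ) (Set.Ioi 0) :=
    Ioo_mem_nhdsGT (by norm_num)
  filter_upwards [this] with r hr
  have hr1 : r ≤ 1 := by linarith [hr.2]
  exact ⟨hr.1, hr.2, isPositive_add_smul_sub hx ha hr.1 hr1,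
    convex_feasible.add_smul_sub_mem hx haf ⟨hr.1.le, hr1⟩⟩

theorem tendsto_add_smul_sub_domF (hU : M.RegularUtilities) {x a : N → K → ℝ}
    (hx : x ∈ feasible N K) (ha : IsPositive a) (haf : a ∈ feasible N K) :
    Filter.Tendsto (fun r : ℝ => x + r • (a - x)) (nhdsWithin 0 (Set.Ioi 0))
      (nhdsWithin x M.domF) :=
  tendsto_nhdsWithin_iff.2 ⟨tendsto_add_smul_sub x a,
    (eventually_add_smul_sub hx ha haf).mono fun _ hr => hr.2.2.1.mem_domF hU hr.2.2.2⟩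

theorem monotoneF_le (hmono : M.StrictlyMonotoneF) {x y : N → K → ℝ} (hx : x ∈ M.domF)
    (hy : y ∈ M.domF) : pairing (M.F x - M.F y) (x - y) ≤ 0 := by
  by_cases h : x = y
  · subst h; simp [pairing]
  · exact (hmono x hx y hy h).le

/-- The weak (Minty) form of the variational inequality, tested at positive allocations. -/
def IsMintySolution (M : FisherMarket N K) (x : N → K → ℝ) : Prop :=
  x ∈ feasible N K ∧ ∀ y ∈ feasible N K, IsPositive y → 1 ≤ pairing (M.F y) x

theorem exists_isMintySolution (hU : M.RegularUtilities) (hmono : M.StrictlyMonotoneF) :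
    ∃ x, M.IsMintySolution x := by
  have := M.nonempty_buyers
  let ι := {y : N → K → ℝ // y ∈ feasible N K ∧ IsPositive y}
  have hdom : ∀ i : ι, i.1 ∈ M.domF := fun i => i.2.2.mem_domF hU i.2.1
  obtain ⟨x, hx, hxi⟩ := (isCompact_feasible (N := N) (K := K)).inter_iInter_nonempty
    (fun i : ι => {x | 1 ≤ pairing (M.F i.1) x})
    (fun i => isClosed_le continuous_const
      (continuous_pairing.comp (continuous_const.prodMk continuous_id))) fun u => by
    rcases u.eq_empty_or_nonempty with rfl | hu
    · exact ⟨equalShares N K, equalShares_mem_feasible, by simp⟩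
    have : Nonempty u := hu.to_subtype
    -- For A i j = ⟨F(yᵢ), yⱼ⟩ - 1, monotonicity and ⟨F(y), y⟩ = 1 say exactly that A + Aᵀ ≥ 0. The
    -- weights w then give a convex combination of the yⱼ meeting every constraint.
    obtain ⟨w, hw, hpos⟩ := exists_stdSimplex_mulVec_nonneg
      (Matrix.of fun i j : u => pairing (M.F i.1.1) j.1.1 - 1) fun i j => by
        have h := monotoneF_le hmono (hdom i.1) (hdom j.1)
        rw [pairing_sub_left, pairing_sub_right, pairing_sub_right, pairing_F_self (hdom i.1),
          pairing_F_self (hdom j.1)] at h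
        simp only [Matrix.of_apply]
        linarith
    refine ⟨∑ j : u, w j • j.1.1, ?_, ?_⟩
    · exact convex_feasible.sum_mem (fun j _ => hw.1 j) hw.2 fun j _ => j.1.2.1
    · simp only [Set.mem_iInter]
      intro i hi
      have h := hpos ⟨i, hi⟩
      simp only [Matrix.mulVec, dotProduct, Matrix.of_apply, sub_mul, one_mul,
        Finset.sum_sub_distrib, hw.2] at h
      change 1 ≤ pairing (M.F i.1) _
      simp only [pairing_sum_right, pairing_smul_right]
      simp only [mul_comm] at h ⊢
      linarith
  refine ⟨x, hx, fun y hy hpos => ?_⟩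
  exact Set.mem_iInter.1 hxi ⟨y, hy, hpos⟩

theorem IsMintySolution.pairing_segment_nonpos (hU : M.RegularUtilities) {x a : N → K → ℝ}
    (hx : M.IsMintySolution x) {r : ℝ} (hr : 0 < r) (hpos : IsPositive (x + r • (a - x)))
    (hf : x + r • (a - x) ∈ feasible N K) :
    pairing (M.F (x + r • (a - x))) (a - x) ≤ 0 := by
  have h1 := hx.2 _ hf hpos
  have h2 := pairing_F_self (hpos.mem_domF hU hf)
  have h3 : pairing (M.F (x + r • (a - x))) (x + r • (a - x)) =
    pairing (M.F (x + r • (a - x))) x + r * pairing (M.F (x + r • (a - x))) (a - x) := by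
    rw [pairing_add_right, pairing_smul_right]
  by_contra! h
  have := mul_pos hr h
  linarith

/-- At points y close to x on the segment towards equal shares e, ⟨F(y), e⟩ ≤ ⟨F(y), x⟩ ≤ 2⟨F(y), y⟩
= 2. So the entries of F(y) are at most 2|N|, and F cannot blow up at x. -/
theorem IsMintySolution.mem_domF (hU : M.RegularUtilities) (hcont : M.ContinuousF)
    {x : N → K → ℝ} (hx : M.IsMintySolution x) : x ∈ M.domF := by
  have := M.nonempty_buyers
  by_contra hxD
  have hcard : (0 : ℝ) < Fintype.card N := by exact_mod_cast Fintype.card_pos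
  have htop := (hcont.2 x hx.1 hxD).comp
    (tendsto_add_smul_sub_domF hU hx.1 equalShares_pos equalShares_mem_feasible)
  obtain ⟨r, hlarge, hr0, hr1, hpos, hf⟩ :=
    ((htop.eventually_gt_atTop (2 * (Fintype.card N : ℝ))).and
      (eventually_add_smul_sub hx.1 equalShares_pos equalShares_mem_feasible)).exists
  simp only [Function.comp_apply] at hlarge
  have hseg := hx.pairing_segment_nonpos hU hr0 hpos hf
  set y := x + r • (equalShares N K - x) with hy
  have hFnn := F_nonneg hU hpos
  have hyx : pairing (M.F y) ((1 / 2 : ℝ) • x) ≤ pairing (M.F y) y := by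
    refine pairing_mono_right hFnn fun n k => ?_
    have h1 := mul_nonneg (show 0 ≤ 1 / 2 - r by linarith) (hx.1.1 n k)
    have h2 := mul_pos hr0 (equalShares_pos (N := N) (K := K) n k)
    simp only [hy, Pi.add_apply, Pi.smul_apply, Pi.sub_apply, smul_eq_mul]
    linarith
  rw [pairing_smul_right, pairing_F_self (hpos.mem_domF hU hf)] at hyx
  rw [pairing_sub_right] at hseg
  refine hlarge.not_ge ((pi_norm_le_iff_of_nonneg (by positivity)).2 fun n =>
    (pi_norm_le_iff_of_nonneg (by positivity)).2 fun k => ?_)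
  rw [Real.norm_of_nonneg (hFnn n k)]
  have hle : M.F y n k * (Fintype.card N : ℝ)⁻¹ ≤ pairing (M.F y) (equalShares N K) :=
    (Finset.single_le_sum (f := fun k => M.F y n k * equalShares N K n k)
      (fun k _ => mul_nonneg (hFnn n k) (equalShares_pos n k).le) (Finset.mem_univ k)).trans
    (Finset.single_le_sum (f := fun n => ∑ k, M.F y n k * equalShares N K n k)
      (fun n _ => Finset.sum_nonneg fun k _ => mul_nonneg (hFnn n k) (equalShares_pos n k).le)
      (Finset.mem_univ n))
  rw [← div_eq_mul_inv, div_le_iff₀ hcard] at hle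
  nlinarith

/-- Minty's trick: let r → 0 in the inequality at x + r(a - x). Positive a come first, since F is
controlled on such segments; other a are limits of positive ones. -/
theorem IsMintySolution.isVariationalEquilibrium (hU : M.RegularUtilities)
    (hcont : M.ContinuousF) {x : N → K → ℝ} (hx : M.IsMintySolution x) :
    M.IsVariationalEquilibrium x := by
  have := M.nonempty_buyers
  have hxD := hx.mem_domF hU hcont
  have hpos : ∀ a ∈ feasible N K, IsPositive a → pairing (M.F x) (a - x) ≤ 0 := by
    intro a haf ha
    have h1 : Filter.Tendsto (fun r : ℝ => pairing (M.F (x + r • (a - x))) (a - x))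
        (nhdsWithin 0 (Set.Ioi 0)) (nhds (pairing (M.F x) (a - x))) := by
      have h2 := (hcont.1 x hxD).tendsto.comp (tendsto_add_smul_sub_domF hU hx.1 ha haf)
      have h3 : Continuous fun v : N → K → ℝ => pairing v (a - x) :=
        continuous_pairing.comp (continuous_id.prodMk continuous_const)
      exact (h3.tendsto _).comp h2
    refine le_of_tendsto h1 ?_
    filter_upwards [eventually_add_smul_sub hx.1 ha haf] with r hr
    exact hx.pairing_segment_nonpos hU hr.1 hr.2.2.1 hr.2.2.2
  refine ⟨hxD, fun a ha => ?_⟩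
  have h3 : Continuous fun v : N → K → ℝ => pairing (M.F x) (v - x) :=
    continuous_pairing.comp (continuous_const.prodMk (continuous_id.sub continuous_const))
  refine le_of_tendsto ((h3.tendsto _).comp (tendsto_add_smul_sub a (equalShares N K))) ?_
  filter_upwards [eventually_add_smul_sub ha equalShares_pos equalShares_mem_feasible] with r hr
  exact hpos _ hr.2.2.2 hr.2.2.1

theorem IsVariationalEquilibrium.one_lt_pairing (hmono : M.StrictlyMonotoneF) {x y : N → K → ℝ}
    (hx : M.IsVariationalEquilibrium x) (hy : y ∈ M.domF) (hne : y ≠ x) :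
    1 < pairing (M.F y) x := by
  have h1 := hmono y hy x hx.1 hne
  have h2 := hx.2 y hy.1
  rw [pairing_sub_left, pairing_sub_right, pairing_F_self hy] at h1
  linarith

theorem IsVariationalEquilibrium.isMintySolution (hU : M.RegularUtilities)
    (hmono : M.StrictlyMonotoneF) {x : N → K → ℝ} (hx : M.IsVariationalEquilibrium x) :
    M.IsMintySolution x := by
  refine ⟨hx.1.1, fun y hy hpos => ?_⟩
  by_cases h : y = x
  · rw [h, pairing_F_self hx.1]
  · exact (hx.one_lt_pairing hmono (hpos.mem_domF hU hy) h).le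

theorem IsVariationalEquilibrium.unique (hmono : M.StrictlyMonotoneF) {x y : N → K → ℝ}
    (hx : M.IsVariationalEquilibrium x) (hy : M.IsVariationalEquilibrium y) : y = x := by
  by_contra h
  have h1 := hx.one_lt_pairing hmono hy.1 h
  have h2 := hy.2 x hx.1.1
  rw [pairing_sub_right, pairing_F_self hy.1] at h2
  linarith

/-- At the equilibrium the supply of every good is exhausted. -/
theorem IsVariationalEquilibrium.sum_eq_one (hU : M.RegularUtilities) (hcont : M.ContinuousF)
    (hmono : M.StrictlyMonotoneF) {x : N → K → ℝ} (hx : M.IsVariationalEquilibrium x) (k : K) :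
    ∑ n, x n k = 1 := by
  obtain ⟨m⟩ := M.nonempty_buyers
  -- Handing all unsold supply to one buyer preserves the Minty inequalities, as F ≥ 0 at positive
  -- points; uniqueness then forces a = x.
  set a : N → K → ℝ := Function.update x m fun j => x m j + (1 - ∑ n, x n j) with ha
  have hsum : ∀ j, ∑ n, a n j = 1 := fun j => by
    have h1 := Finset.add_sum_erase Finset.univ (fun n => x n j) (Finset.mem_univ m)
    rw [← Finset.add_sum_erase _ _ (Finset.mem_univ m)]
    have h2 : ∑ n ∈ Finset.univ.erase m, a n j = ∑ n ∈ Finset.univ.erase m, x n j :=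
      Finset.sum_congr rfl fun n hn => by simp [ha, Finset.ne_of_mem_erase hn]
    rw [h2]
    simp only [ha, Function.update_self]
    linarith
  have hle : ∀ n j, x n j ≤ a n j := fun n j => by
    by_cases h : n = m
    · subst h
      have := hx.1.1.2 j
      simp only [ha, Function.update_self]
      linarith
    · simp [ha, h]
  have haM : M.IsMintySolution a :=
    ⟨⟨fun n j => (hx.1.1.1 n j).trans (hle n j), fun j => (hsum j).le⟩, fun y hy hpos =>
      ((hx.isMintySolution hU hmono).2 y hy hpos).trans
        (pairing_mono_right (F_nonneg hU hpos) hle)⟩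
  have := hx.unique hmono (haM.isVariationalEquilibrium hU hcont)
  rw [← this]
  exact hsum k

/-- F is bounded on `domF` near x, but blows up at feasible points outside `domF`, each of which is
a limit of positive points, hence of points of `domF`. -/
theorem exists_closedBall_inter_feasible_subset_domF (hU : M.RegularUtilities)
    (hcont : M.ContinuousF) {x : N → K → ℝ} (hx : x ∈ M.domF) :
    ∃ ε > 0, Metric.closedBall x ε ∩ feasible N K ⊆ M.domF := by
  have := M.nonempty_buyers
  have hev : ∀ᶠ y in nhdsWithin x M.domF, ‖M.F y‖ < ‖M.F x‖ + 1 :=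
    (hcont.1 x hx).norm.eventually_lt_const (lt_add_one _)
  obtain ⟨ε, hε, hball⟩ := Metric.mem_nhdsWithin_iff.1 hev
  refine ⟨ε / 2, by positivity, fun w hw => ?_⟩
  by_contra hwD
  have hlim := tendsto_add_smul_sub_domF hU hw.2 equalShares_pos equalShares_mem_feasible
  have hnear : ∀ᶠ r : ℝ in nhdsWithin 0 (Set.Ioi 0),
      w + r • (equalShares N K - w) ∈ Metric.ball x ε := by
    refine tendsto_add_smul_sub w (equalShares N K) (Metric.isOpen_ball.mem_nhds ?_)
    have := Metric.mem_closedBall.1 hw.1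
    exact Metric.mem_ball.2 (by linarith)
  obtain ⟨r, h1, h2, h3⟩ := ((((hcont.2 w hw.2 hwD).comp hlim).eventually_gt_atTop
    (‖M.F x‖ + 1)).and (hnear.and
      (eventually_add_smul_sub hw.2 equalShares_pos equalShares_mem_feasible))).exists
  have h4 := hball ⟨h2, h3.2.2.1.mem_domF hU h3.2.2.2⟩
  exact absurd (Set.mem_ofPred.1 h4) (not_lt.2 (le_of_lt h1))

/-- Away from the equilibrium `x`, the inequality `1 < ⟨F y, x⟩` holds uniformly. -/
theorem IsVariationalEquilibrium.exists_gap (hU : M.RegularUtilities) (hcont : M.ContinuousF)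
    (hmono : M.StrictlyMonotoneF) {x : N → K → ℝ} (hx : M.IsVariationalEquilibrium x)
    {δ : ℝ} (hδ : 0 < δ) : ∃ c > 0, ∀ y ∈ M.domF, δ ≤ dist y x → 1 + c ≤ pairing (M.F y) x := by
  obtain ⟨ε, hε, hsub⟩ := exists_closedBall_inter_feasible_subset_domF hU hcont hx.1
  set ρ := min δ ε with hρ
  have hρ0 : 0 < ρ := lt_min hδ hε
  have hSD : Metric.sphere x ρ ∩ feasible N K ⊆ M.domF := fun z hz =>
    hsub ⟨Metric.closedBall_subset_closedBall (min_le_right _ _)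
      (Metric.sphere_subset_closedBall hz.1), hz.2⟩
  have hScompact : IsCompact (Metric.sphere x ρ ∩ feasible N K) :=
    isCompact_feasible.inter_left Metric.isClosed_sphere
  have hScont : ContinuousOn (fun z => pairing (M.F z) x) (Metric.sphere x ρ ∩ feasible N K) := by
    have h3 : Continuous fun v : N → K → ℝ => pairing v x :=
      continuous_pairing.comp (continuous_id.prodMk continuous_const)
    exact h3.comp_continuousOn (hcont.1.mono hSD)
  obtain ⟨c, hc, hcS⟩ : ∃ c > 0, ∀ z ∈ Metric.sphere x ρ ∩ feasible N K,
      1 + c ≤ pairing (M.F z) x := by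
    rcases (Metric.sphere x ρ ∩ feasible N K).eq_empty_or_nonempty with he | hne
    · exact ⟨1, one_pos, by simp [he]⟩
    · obtain ⟨z, hz, hmin⟩ := hScompact.exists_isMinOn hne hScont
      refine ⟨pairing (M.F z) x - 1, ?_, fun w hw => ?_⟩
      · have := hx.one_lt_pairing hmono (hSD hz) (Metric.ne_of_mem_sphere hz.1 hρ0.ne')
        linarith
      · have := isMinOn_iff.1 hmin w hw
        linarith
  refine ⟨c, hc, fun y hy hdist => ?_⟩
  have hd0 : 0 < dist y x := hδ.trans_le hdist
  have hρd : ρ ≤ dist y x := (min_le_left _ _).trans hdist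
  -- The segment from x to y meets the sphere at z. Monotonicity between z and y carries the gap
  -- outwards: ⟨F(y), y - x⟩ ≤ ⟨F(z), y - x⟩ ≤ -c.
  set s := ρ / dist y x with hs
  have hs0 : 0 < s := div_pos hρ0 hd0
  have hs1 : s ≤ 1 := (div_le_one hd0).2 hρd
  have hzf : x + s • (y - x) ∈ feasible N K :=
    convex_feasible.add_smul_sub_mem hx.1.1 hy.1 ⟨hs0.le, hs1⟩
  have hzS : x + s • (y - x) ∈ Metric.sphere x ρ := by
    rw [mem_sphere_iff_norm, add_sub_cancel_left, norm_smul, Real.norm_of_nonneg hs0.le,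
      ← dist_eq_norm, hs, div_mul_cancel₀ _ hd0.ne']
  have hz := hcS _ ⟨hzS, hzf⟩
  have hzD := hSD ⟨hzS, hzf⟩
  set z := x + s • (y - x) with hzdef
  have hself := pairing_F_self hzD
  have hzeq : pairing (M.F z) z = pairing (M.F z) x + s * pairing (M.F z) (y - x) := by
    conv_lhs => rw [show pairing (M.F z) z = pairing (M.F z) (x + s • (y - x)) from rfl]
    rw [pairing_add_right, pairing_smul_right]
  have hgap : c ≤ -pairing (M.F z) (y - x) := by
    have : c ≤ s * -pairing (M.F z) (y - x) := by linarith
    have h0 : 0 < -pairing (M.F z) (y - x) := by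
      by_contra! h
      have := mul_nonpos_of_nonneg_of_nonpos hs0.le h
      linarith
    exact this.trans (mul_le_of_le_one_left h0.le hs1)
  rcases hs1.eq_or_lt with h1 | h1
  · have : z = y := by rw [hzdef, h1]; simp
    rwa [this] at hz
  · have hm := monotoneF_le hmono hy hzD
    have hyz : y - z = (1 - s) • (y - x) := by
      rw [hzdef, sub_smul, one_smul]; abel
    rw [hyz, pairing_smul_right] at hm
    have hm' := nonpos_of_mul_nonpos_right hm (sub_pos.2 h1)
    rw [pairing_sub_left] at hm'
    have : pairing (M.F y) (y - x) = 1 - pairing (M.F y) x := by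
      rw [pairing_sub_right, pairing_F_self hy]
    linarith

end FisherMarket

/-! ### Logarithm inequalities and a drift criterion. -/

theorem Real.sub_two_mul_sq_le_log_one_add {u : ℝ} (hu : -(1 / 2) ≤ u) :
    u - 2 * u ^ 2 ≤ Real.log (1 + u) := by
  have h0 : 0 < 1 + u := by linarith
  refine le_trans ?_ (Real.one_sub_inv_le_log_of_pos h0)
  have h1 : (1 + u)⁻¹ ≤ 2 := by
    rw [inv_le_comm₀ h0 two_pos]; linarith
  have h2 : 1 - (1 + u)⁻¹ = u - u ^ 2 * (1 + u)⁻¹ := by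
    field_simp; ring
  rw [h2]
  nlinarith [mul_le_mul_of_nonneg_left h1 (sq_nonneg u)]

/-- The pointwise form of the bound of the Kullback-Leibler divergence by the squared Hellinger
distance. -/
theorem Real.sq_sqrt_sub_sqrt_le {z x : ℝ} (hz : 0 ≤ z) (hx : 0 < x) :
    (√z - √x) ^ 2 + z - x ≤ z * (Real.log z - Real.log x) := by
  rcases hz.eq_or_lt with rfl | hz
  · simp [Real.sq_sqrt hx.le]
  have ha := Real.sqrt_pos.2 hz
  have hb := Real.sqrt_pos.2 hx
  -- Multiplied by 2z, log(√x/√z) ≤ √x/√z - 1 is the claim.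
  have h1 := Real.log_le_sub_one_of_pos (div_pos hb ha)
  rw [Real.log_div hb.ne' ha.ne', Real.log_sqrt hx.le, Real.log_sqrt hz.le] at h1
  have h2 := mul_le_mul_of_nonneg_left h1 (show 0 ≤ 2 * z by linarith)
  have h3 : z * (√x / √z) = √z * √x := by
    rw [mul_div_assoc', div_eq_iff ha.ne']
    nth_rewrite 1 [← Real.mul_self_sqrt hz.le]
    ring
  have h4 := Real.sq_sqrt hz.le
  have h5 := Real.sq_sqrt hx.le
  nlinarith

/-- A nonnegative sequence that drifts down at a rate bounded away from zero, wherever it is bounded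
away from zero, tends to zero, provided that the steps tend to zero and have infinite sum. -/
theorem tendsto_zero_of_drift {E α : ℕ → ℝ} {C : ℝ} (hE : ∀ t, 0 ≤ E t)
    (hα : ∀ t, 0 ≤ α t) (hα_lim : Filter.Tendsto α Filter.atTop (nhds 0))
    (hα_sum : Filter.Tendsto (fun T => ∑ t ∈ Finset.range T, α t) Filter.atTop Filter.atTop)
    (hstep : ∀ᶠ t in Filter.atTop, E (t + 1) ≤ E t + C * α t ^ 2)
    (hdrift : ∀ η > 0, ∃ c > 0, ∀ᶠ t in Filter.atTop,
      η ≤ E t → E (t + 1) ≤ E t - c * α t + C * α t ^ 2) :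
    Filter.Tendsto E Filter.atTop (nhds 0) := by
  rw [Metric.tendsto_atTop]
  intro ε hε
  -- Above ε/2 the drift forces descent, and since ∑ α diverges E must get below ε/2; from there a
  -- single step adds less than ε/2, so E stays below ε.
  obtain ⟨c, hc, hd⟩ := hdrift (ε / 2) (by positivity)
  have hlin : ∀ᶠ t in Filter.atTop, C * α t < c / 2 := by
    have h := hα_lim.const_mul C
    rw [mul_zero] at h
    exact h.eventually_lt_const (by positivity)
  have hsq : ∀ᶠ t in Filter.atTop, C * α t ^ 2 < ε / 2 := by
    have h := (hα_lim.pow 2).const_mul C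
    simp only [ne_eq, OfNat.ofNat_ne_zero, not_false_eq_true, zero_pow, mul_zero] at h
    exact h.eventually_lt_const (by positivity)
  obtain ⟨T, hT⟩ := Filter.eventually_atTop.1 (hstep.and (hd.and (hlin.and hsq)))
  have hdown : ∀ t ≥ T, ε / 2 ≤ E t → E (t + 1) ≤ E t - c / 2 * α t := fun t ht h => by
    obtain ⟨-, h2, h3, -⟩ := hT t ht
    have := h2 h
    nlinarith [mul_le_mul_of_nonneg_right h3.le (hα t)]
  obtain ⟨t₀, ht₀, hlt⟩ : ∃ t₀ ≥ T, E t₀ < ε / 2 := by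
    by_contra! hcon
    have hb : ∀ t ≥ T, c / 2 * ∑ s ∈ Finset.range t, α s ≤
        c / 2 * ∑ s ∈ Finset.range T, α s + E T - E t := by
      intro t ht
      induction t, ht using Nat.le_induction with
      | base => simp
      | succ t ht ih =>
        have := hdown t ht (hcon t ht)
        rw [Finset.sum_range_succ, mul_add]
        linarith
    obtain ⟨t, ht, htT⟩ := (((hα_sum.const_mul_atTop (half_pos hc)).eventually_gt_atTop
      (c / 2 * ∑ s ∈ Finset.range T, α s + E T)).and (Filter.eventually_ge_atTop T)).exists
    have := hb t htT
    have := hE t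
    linarith
  refine ⟨t₀, fun t ht => ?_⟩
  rw [Real.dist_0_eq_abs, abs_of_nonneg (hE t)]
  induction t, ht using Nat.le_induction with
  | base => linarith
  | succ t ht ih =>
    obtain ⟨h1, -, -, h4⟩ := hT t (ht₀.trans ht)
    by_cases h : ε / 2 ≤ E t
    · have := hdown t (ht₀.trans ht) h
      have := mul_nonneg (half_pos hc).le (hα t)
      linarith
    · linarith

/-! ### The divergence and the truncated pairing. -/

namespace FisherMarket

variable {N K : Type*} [Fintype N] [Fintype K] [DecidableEq N] [DecidableEq K]
  {M : FisherMarket N K}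

/-- The divergence `∑ z log (z / x)` of an allocation `x` from `z`. -/
noncomputable def divergence (z x : N → K → ℝ) : ℝ :=
  ∑ n, ∑ k, z n k * (Real.log (z n k) - Real.log (x n k))

theorem sum_sq_sqrt_sub_sqrt_le_divergence {z x : N → K → ℝ} (hz : ∀ n k, 0 ≤ z n k)
    (hx : IsPositive x) (hsum : ∀ k, ∑ n, z n k = ∑ n, x n k) :
    ∑ n, ∑ k, (√(z n k) - √(x n k)) ^ 2 ≤ divergence z x := by
  have h := Finset.sum_le_sum fun n (_ : n ∈ Finset.univ) => Finset.sum_le_sum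
    fun k (_ : k ∈ Finset.univ) => Real.sq_sqrt_sub_sqrt_le (hz n k) (hx n k)
  have h1 : ∑ n, ∑ k, z n k = ∑ n, ∑ k, x n k := by
    rw [Finset.sum_comm, Finset.sum_comm (f := fun n k => x n k)]
    exact Finset.sum_congr rfl fun k _ => hsum k
  simp only [Finset.sum_add_distrib, Finset.sum_sub_distrib, h1] at h
  simpa [divergence] using h

theorem divergence_nonneg {z x : N → K → ℝ} (hz : ∀ n k, 0 ≤ z n k)
    (hx : IsPositive x) (hsum : ∀ k, ∑ n, z n k = ∑ n, x n k) : 0 ≤ divergence z x :=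
  (Finset.sum_nonneg fun _ _ => Finset.sum_nonneg fun _ _ => sq_nonneg _).trans
    (sum_sq_sqrt_sub_sqrt_le_divergence hz hx hsum)

theorem tendsto_of_divergence {z : N → K → ℝ} {x : ℕ → N → K → ℝ} (hz : ∀ n k, 0 ≤ z n k)
    (hx : ∀ t, IsPositive (x t)) (hsum : ∀ t k, ∑ n, z n k = ∑ n, x t n k)
    (h : Filter.Tendsto (fun t => divergence z (x t)) Filter.atTop (nhds 0)) :
    Filter.Tendsto x Filter.atTop (nhds z) := by
  refine tendsto_pi_nhds.2 fun n => tendsto_pi_nhds.2 fun k => ?_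
  have h1 : Filter.Tendsto (fun t => (√(z n k) - √(x t n k)) ^ 2) Filter.atTop (nhds 0) := by
    refine squeeze_zero (fun t => sq_nonneg _) (fun t => ?_) h
    refine le_trans ?_ (sum_sq_sqrt_sub_sqrt_le_divergence hz (hx t) (hsum t))
    exact (Finset.single_le_sum (f := fun k => (√(z n k) - √(x t n k)) ^ 2)
      (fun k _ => sq_nonneg _) (Finset.mem_univ k)).trans
      (Finset.single_le_sum (f := fun n => ∑ k, (√(z n k) - √(x t n k)) ^ 2)
        (fun n _ => Finset.sum_nonneg fun k _ => sq_nonneg _) (Finset.mem_univ n))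
  have h2 : Filter.Tendsto (fun t => √(z n k) - √(x t n k)) Filter.atTop (nhds 0) := by
    have := h1.sqrt
    simp only [Real.sqrt_sq_eq_abs, Real.sqrt_zero] at this
    exact (tendsto_zero_iff_abs_tendsto_zero _).2 this
  have h3 := ((tendsto_const_nhds (x := √(z n k))).sub h2).pow 2
  simp only [sub_sub_cancel, sub_zero, Real.sq_sqrt (hz n k)] at h3
  exact h3.congr fun t => Real.sq_sqrt (hx t n k).le

/-- Continuity at z survives zero entries of z, whose terms vanish identically. -/
theorem exists_divergence_lt {z : N → K → ℝ} {η : ℝ} (hη : 0 < η) :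
    ∃ δ > 0, ∀ x, dist x z < δ → divergence z x < η := by
  have hc : ContinuousAt (divergence z) z := by
    unfold divergence
    refine tendsto_finsetSum _ fun n _ => tendsto_finsetSum _ fun k _ => ?_
    by_cases h : z n k = 0
    · simp [h]
    · have h1 : ContinuousAt (fun x : N → K → ℝ => x n k) z :=
        (continuous_apply_apply n k).continuousAt
      exact (tendsto_const_nhds.sub (h1.log h)).const_mul _
  have h0 : divergence z z = 0 := by simp [divergence]
  obtain ⟨δ, hδ, h⟩ := Metric.continuousAt_iff.1 hc η hη
  refine ⟨δ, hδ, fun x hx => ?_⟩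
  have := h hx
  rw [h0, Real.dist_0_eq_abs] at this
  exact (le_abs_self _).trans_lt this

theorem exists_truncation (z : N → K → ℝ) :
    ∃ L ≥ 0, ∀ n k, 0 < z n k → 2 ≤ z n k * L := by
  refine ⟨∑ n, ∑ k, 2 / |z n k|, by positivity, fun n k h => ?_⟩
  have : 2 / |z n k| ≤ ∑ n, ∑ k, 2 / |z n k| :=
    (Finset.single_le_sum (f := fun k => 2 / |z n k|) (fun k _ => by positivity)
      (Finset.mem_univ k)).trans
    (Finset.single_le_sum (f := fun n => ∑ k, 2 / |z n k|)
      (fun n _ => Finset.sum_nonneg fun k _ => by positivity) (Finset.mem_univ n))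
  rw [abs_of_pos h, div_le_iff₀ h] at this
  rwa [mul_comm] at this

/-- Either truncation cuts nothing on the support of z, or one cut entry alone contributes z L ≥ 2.
Any constant above 1 would serve in place of 2, since the drift is measured against 1. -/
theorem min_pairing_le_sum_truncated {u z : N → K → ℝ} {L : ℝ} (hL : 0 ≤ L)
    (hu : ∀ n k, 0 ≤ u n k) (hz : ∀ n k, 0 ≤ z n k) (hzL : ∀ n k, 0 < z n k → 2 ≤ z n k * L) :
    min (pairing u z) 2 ≤ ∑ n, ∑ k, z n k * min (u n k) L := by
  have hnn : ∀ n k, 0 ≤ z n k * min (u n k) L := fun n k =>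
    mul_nonneg (hz n k) (le_min (hu n k) hL)
  by_cases h : ∀ n k, 0 < z n k → u n k ≤ L
  · refine (min_le_left _ _).trans (le_of_eq ?_)
    refine Finset.sum_congr rfl fun n _ => Finset.sum_congr rfl fun k _ => ?_
    rcases (hz n k).eq_or_lt with h0 | h0
    · simp [← h0]
    · rw [min_eq_left (h n k h0), mul_comm]
  · push Not at h
    obtain ⟨n, k, h0, hlt⟩ := h
    refine (min_le_right _ _).trans ((hzL n k h0).trans ?_)
    have := (Finset.single_le_sum (f := fun k => z n k * min (u n k) L) (fun k _ => hnn n k)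
      (Finset.mem_univ k)).trans
      (Finset.single_le_sum (f := fun n => ∑ k, z n k * min (u n k) L)
        (fun n _ => Finset.sum_nonneg fun k _ => hnn n k) (Finset.mem_univ n))
    simpa [min_eq_right hlt.le] using this

/-! ### The trading-post dynamics. -/

theorem price_pos [Nonempty N] {b : N → K → ℝ} (hb : IsPositive b) (k : K) : 0 < price b k :=
  Finset.sum_pos (fun n _ => hb n k) Finset.univ_nonempty

theorem allocation_pos [Nonempty N] {b : N → K → ℝ} (hb : IsPositive b) :
    IsPositive (allocation b) := fun n k => div_pos (hb n k) (price_pos hb k)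

theorem sum_allocation [Nonempty N] {b : N → K → ℝ} (hb : IsPositive b) (k : K) :
    ∑ n, allocation b n k = 1 := by
  simp only [allocation, ← Finset.sum_div]
  exact div_self (price_pos hb k).ne'

theorem allocation_mem_feasible [Nonempty N] {b : N → K → ℝ} (hb : IsPositive b) :
    allocation b ∈ feasible N K :=
  ⟨fun n k => (allocation_pos hb n k).le, fun k => (sum_allocation hb k).le⟩

theorem allocation_mem_domF [Nonempty N] (hU : M.RegularUtilities) {b : N → K → ℝ}
    (hb : IsPositive b) : allocation b ∈ M.domF :=
  (allocation_pos hb).mem_domF hU (allocation_mem_feasible hb)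

/-- The value `∑ₙ xₙₖ Fₙₖ(x)` of good `k` at the allocation `x`. -/
noncomputable def goodValue (M : FisherMarket N K) (x : N → K → ℝ) (k : K) : ℝ :=
  ∑ n, x n k * M.F x n k

theorem sum_goodValue {x : N → K → ℝ} (hx : x ∈ M.domF) : ∑ k, M.goodValue x k = 1 := by
  rw [← pairing_F_self hx]
  simp only [goodValue, pairing]
  rw [Finset.sum_comm]
  simp only [mul_comm]

theorem goodValue_le_one (hU : M.RegularUtilities) {x : N → K → ℝ} (hx : IsPositive x)
    (hf : x ∈ feasible N K) (k : K) : M.goodValue x k ≤ 1 := by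
  rw [← sum_goodValue (hx.mem_domF hU hf)]
  exact Finset.single_le_sum (f := fun k => M.goodValue x k)
    (fun k _ => Finset.sum_nonneg fun n _ => mul_nonneg (hx n k).le (F_nonneg hU hx n k))
    (Finset.mem_univ k)

theorem bids_succ (α : ℕ → ℝ) (b₀ : N → K → ℝ) (t : ℕ) (n : N) (k : K) :
    M.bids α b₀ (t + 1) n k = M.bids α b₀ t n k *
      (1 + α t * (M.F (allocation (M.bids α b₀ t)) n k - price (M.bids α b₀ t) k)) := by
  simp only [bids]
  ring

theorem price_bids_succ [Nonempty N] (α : ℕ → ℝ) (b₀ : N → K → ℝ) {t : ℕ}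
    (hb : IsPositive (M.bids α b₀ t)) (k : K) :
    price (M.bids α b₀ (t + 1)) k = price (M.bids α b₀ t) k *
      (1 + α t * (M.goodValue (allocation (M.bids α b₀ t)) k - price (M.bids α b₀ t) k)) := by
  have hp := (price_pos hb k).ne'
  set b := M.bids α b₀ t with hbdef
  have h1 : price b k * M.goodValue (allocation b) k = ∑ n, b n k * M.F (allocation b) n k := by
    rw [goodValue, Finset.mul_sum]
    refine Finset.sum_congr rfl fun n _ => ?_
    rw [← mul_assoc, allocation, mul_div_cancel₀ _ hp]
  have h2 : price (M.bids α b₀ (t + 1)) k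
      = ∑ n, (b n k + α t * (b n k * M.F (allocation b) n k) - α t * price b k * b n k) := by
    refine Finset.sum_congr rfl fun n _ => ?_
    rw [bids_succ, ← hbdef]
    ring
  rw [h2, Finset.sum_sub_distrib, Finset.sum_add_distrib, ← Finset.mul_sum, ← Finset.mul_sum,
    ← h1, show ∑ n, b n k = price b k from rfl]
  ring

/-- The price moves towards the value of the good, which is at most 1; for p ≤ 1 a step α ≤ 1 cannot
overshoot 1, because (1 - p)(1 - αp) ≥ 0. -/
theorem price_bids_succ_le (hU : M.RegularUtilities) {α : ℕ → ℝ} {b₀ : N → K → ℝ} {t : ℕ}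
    (hb : IsPositive (M.bids α b₀ t)) (hα0 : 0 ≤ α t) (hα1 : α t ≤ 1) (k : K) :
    price (M.bids α b₀ (t + 1)) k ≤ max 1 (price (M.bids α b₀ t) k) := by
  have := M.nonempty_buyers
  rw [price_bids_succ α b₀ hb]
  have hp := price_pos hb k
  have hq := goodValue_le_one hU (allocation_pos hb) (allocation_mem_feasible hb) k
  set p := price (M.bids α b₀ t) k
  set q := M.goodValue (allocation (M.bids α b₀ t)) k
  have h1 : p * (1 + α t * (q - p)) ≤ p * (1 + α t * (1 - p)) := by gcongr
  rcases le_total p 1 with h | h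
  · refine le_max_of_le_left (h1.trans ?_)
    have h2 : α t * p ≤ 1 := mul_le_one₀ hα1 hp.le h
    nlinarith [mul_nonneg (sub_nonneg.2 h2) (sub_nonneg.2 h)]
  · refine le_max_of_le_right (h1.trans ?_)
    nlinarith [mul_nonneg (mul_nonneg hα0 hp.le) (sub_nonneg.2 h)]

theorem isPositive_bids (hU : M.RegularUtilities) {α : ℕ → ℝ} (hα : ∀ t, 0 ≤ α t)
    {b₀ : N → K → ℝ} (hb₀ : IsPositive b₀) (hsmall : ∀ t k, α t * max 1 (price b₀ k) < 1) (t : ℕ) :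
    IsPositive (M.bids α b₀ t) ∧ ∀ k, price (M.bids α b₀ t) k ≤ max 1 (price b₀ k) := by
  have := M.nonempty_buyers
  induction t with
  | zero => exact ⟨hb₀, fun k => le_max_right _ _⟩
  | succ t ih =>
    refine ⟨fun n k => ?_, fun k => ?_⟩
    · rw [bids_succ]
      refine mul_pos (ih.1 n k) ?_
      have h1 := mul_nonneg (hα t) (F_nonneg hU (allocation_pos ih.1) n k)
      have h2 := mul_le_mul_of_nonneg_left (ih.2 k) (hα t)
      have h3 := hsmall t k
      linarith
    · have hα1 : α t ≤ 1 := by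
        have h1 := mul_le_mul_of_nonneg_left (le_max_left 1 (price b₀ k)) (hα t)
        have h2 := hsmall t k
        linarith
      exact (price_bids_succ_le hU ih.1 (hα t) hα1 k).trans (max_le (le_max_left _ _) (ih.2 k))

theorem exists_price_bound (hU : M.RegularUtilities) {α : ℕ → ℝ} (hα : ∀ t, 0 ≤ α t)
    (hα_lim : Filter.Tendsto α Filter.atTop (nhds 0)) {b₀ : N → K → ℝ}
    (hb : ∀ t, IsPositive (M.bids α b₀ t)) :
    ∃ R ≥ 0, ∀ᶠ t in Filter.atTop, ∀ k, price (M.bids α b₀ t) k ≤ R := by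
  have := M.nonempty_buyers
  obtain ⟨T, hT⟩ := Filter.eventually_atTop.1 (hα_lim.eventually_le_const one_pos)
  have hnn : 0 ≤ ∑ k, price (M.bids α b₀ T) k :=
    Finset.sum_nonneg fun k _ => (price_pos (hb T) k).le
  refine ⟨1 + ∑ k, price (M.bids α b₀ T) k, by linarith, Filter.eventually_atTop.2 ⟨T, fun t ht => ?_⟩⟩
  induction t, ht using Nat.le_induction with
  | base =>
    intro k
    have := Finset.single_le_sum (f := fun k => price (M.bids α b₀ T) k)
      (fun k _ => (price_pos (hb T) k).le) (Finset.mem_univ k)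
    linarith
  | succ t ht ih =>
    exact fun k => (price_bids_succ_le hU (hb t) (hα t) (hT t ht) k).trans
      (max_le (by linarith) (ih k))

/-- One step of the algorithm changes the divergence from `z` by the truncated drift, up to an error
of second order. Truncating `F` keeps the error bounded where `F` blows up. -/
theorem divergence_bids_succ_le (hU : M.RegularUtilities) {α : ℕ → ℝ} (hα : ∀ t, 0 ≤ α t)
    {b₀ : N → K → ℝ} (hb : ∀ t, IsPositive (M.bids α b₀ t)) {z : N → K → ℝ}
    (hz : ∀ n k, 0 ≤ z n k) (hzsum : ∀ k, ∑ n, z n k = 1) {L R : ℝ} (hL : 0 ≤ L)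
    {t : ℕ} (hR : ∀ k, price (M.bids α b₀ t) k ≤ R) (hsmall : α t * (L + R) ≤ 1 / 2) :
    divergence z (allocation (M.bids α b₀ (t + 1))) ≤ divergence z (allocation (M.bids α b₀ t))
      - α t * (∑ n, ∑ k, z n k * min (M.F (allocation (M.bids α b₀ t)) n k) L - 1)
      + 2 * (L + R) ^ 2 * Fintype.card K * α t ^ 2 := by
  have := M.nonempty_buyers
  have hdom := allocation_mem_domF hU (hb t)
  have hFnn := F_nonneg hU (allocation_pos (hb t))
  have hp := fun k => price_pos (hb t) k
  have hbs := fun n k => bids_succ (M := M) α b₀ t n k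
  have hps := fun k => price_bids_succ (M := M) α b₀ (hb t) k
  have hp' := fun k => price_pos (hb (t + 1)) k
  have hb' := hb (t + 1)
  have hbt := hb t
  set b := M.bids α b₀ t
  set b' := M.bids α b₀ (t + 1)
  set f := M.F (allocation b)
  set q := M.goodValue (allocation b)
  -- Positivity of the next bids, not smallness of the step, makes these factors positive: f has no
  -- upper bound here.
  have hf1 : ∀ n k, 0 < 1 + α t * (f n k - price b k) := fun n k =>
    pos_of_mul_pos_right (hbs n k ▸ hb' n k) (hbt n k).le
  have hq1 : ∀ k, 0 < 1 + α t * (q k - price b k) := fun k =>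
    pos_of_mul_pos_right (hps k ▸ hp' k) (hp k).le
  have hlog : ∀ n k, Real.log (allocation b' n k) = Real.log (allocation b n k)
      + Real.log (1 + α t * (f n k - price b k)) - Real.log (1 + α t * (q k - price b k)) := by
    intro n k
    rw [allocation, allocation, Real.log_div (hb' n k).ne' (hp' k).ne',
      Real.log_div (hbt n k).ne' (hp k).ne', hbs, hps, Real.log_mul (hbt n k).ne' (hf1 n k).ne',
      Real.log_mul (hp k).ne' (hq1 k).ne']
    ring
  have hterm : ∀ n k, α t * (min (f n k) L - price b k) - 2 * (L + R) ^ 2 * α t ^ 2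
      ≤ Real.log (1 + α t * (f n k - price b k)) := by
    intro n k
    set m := min (f n k) L with hm
    have hm0 : 0 ≤ m := le_min (hFnn n k) hL
    have hmL : m ≤ L := min_le_right _ _
    have habs : |m - price b k| ≤ L + R := by
      have h1 := hR k
      have h2 := hp k
      exact abs_le.2 ⟨by linarith, by linarith⟩
    have hlow : -(1 / 2) ≤ α t * (m - price b k) := by
      have := mul_le_mul_of_nonneg_left (abs_le.1 habs).1 (hα t)
      linarith
    have hsq : (α t * (m - price b k)) ^ 2 ≤ (L + R) ^ 2 * α t ^ 2 := by
      rw [mul_pow, mul_comm]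
      exact mul_le_mul_of_nonneg_right (sq_le_sq' (abs_le.1 habs).1 (abs_le.1 habs).2) (sq_nonneg _)
    have h1 := Real.sub_two_mul_sq_le_log_one_add hlow
    have h2 : Real.log (1 + α t * (m - price b k)) ≤ Real.log (1 + α t * (f n k - price b k)) := by
      refine Real.log_le_log (by linarith) ?_
      have := mul_le_mul_of_nonneg_left
        (sub_le_sub_right (min_le_left (f n k) L) (price b k)) (hα t)
      linarith
    linarith
  have hlogq : ∀ k, Real.log (1 + α t * (q k - price b k)) ≤ α t * (q k - price b k) := fun k => by
    have := Real.log_le_sub_one_of_pos (hq1 k)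
    linarith
  -- The prices cancel between the bid factor and the price factor. What remains besides the
  -- truncated drift sums to α plus the error, since ∑ q = 1.
  have hmain : ∀ n k, z n k * (Real.log (z n k) - Real.log (allocation b' n k)) ≤
      z n k * (Real.log (z n k) - Real.log (allocation b n k)) - α t * (z n k * min (f n k) L)
        + z n k * (α t * q k + 2 * (L + R) ^ 2 * α t ^ 2) := by
    intro n k
    have h1 := mul_le_mul_of_nonneg_left (hterm n k) (hz n k)
    have h2 := mul_le_mul_of_nonneg_left (hlogq k) (hz n k)
    rw [hlog]
    linarith
  have hsum := Finset.sum_le_sum fun n (_ : n ∈ Finset.univ) => Finset.sum_le_sum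
    fun k (_ : k ∈ Finset.univ) => hmain n k
  have hrest : ∑ n, ∑ k, z n k * (α t * q k + 2 * (L + R) ^ 2 * α t ^ 2)
      = α t + 2 * (L + R) ^ 2 * Fintype.card K * α t ^ 2 := by
    rw [Finset.sum_comm]
    simp only [← Finset.sum_mul, hzsum, one_mul, Finset.sum_add_distrib, ← Finset.mul_sum]
    rw [sum_goodValue hdom, Finset.sum_const, Finset.card_univ, nsmul_eq_mul]
    ring
  simp only [Finset.sum_add_distrib, Finset.sum_sub_distrib, ← Finset.mul_sum] at hsum
  rw [hrest] at hsum
  unfold divergence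
  linarith

theorem tendsto_allocation_bids (hU : M.RegularUtilities) (hcont : M.ContinuousF)
    (hmono : M.StrictlyMonotoneF) {α : ℕ → ℝ} (hα : ∀ t, 0 ≤ α t)
    (hα_lim : Filter.Tendsto α Filter.atTop (nhds 0))
    (hα_sum : Filter.Tendsto (fun T => ∑ t ∈ Finset.range T, α t) Filter.atTop Filter.atTop)
    {z : N → K → ℝ} (hz : M.IsVariationalEquilibrium z) {b₀ : N → K → ℝ}
    (hb : ∀ t, IsPositive (M.bids α b₀ t)) :
    Filter.Tendsto (fun t => allocation (M.bids α b₀ t)) Filter.atTop (nhds z) := by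
  have := M.nonempty_buyers
  have hz0 := hz.1.1.1
  have hzsum := hz.sum_eq_one hU hcont hmono
  have hsum : ∀ t k, ∑ n, z n k = ∑ n, allocation (M.bids α b₀ t) n k := fun t k => by
    rw [hzsum, sum_allocation (hb t)]
  have hpos := fun t => allocation_pos (hb t)
  refine tendsto_of_divergence hz0 hpos hsum ?_
  obtain ⟨L, hL, hzL⟩ := exists_truncation z
  obtain ⟨R, hR0, hR⟩ := exists_price_bound hU hα hα_lim hb
  have hsmall : ∀ᶠ t in Filter.atTop, α t * (L + R) ≤ 1 / 2 := by
    have h := hα_lim.mul_const (L + R)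
    rw [zero_mul] at h
    exact h.eventually_le_const (by norm_num)
  have hstep : ∀ᶠ t in Filter.atTop, divergence z (allocation (M.bids α b₀ (t + 1)))
      ≤ divergence z (allocation (M.bids α b₀ t))
        - α t * (min (pairing (M.F (allocation (M.bids α b₀ t))) z) 2 - 1)
        + 2 * (L + R) ^ 2 * Fintype.card K * α t ^ 2 := by
    filter_upwards [hR, hsmall] with t hRt ht
    have h1 := divergence_bids_succ_le hU hα hb hz0 hzsum hL hRt ht
    have h2 := mul_le_mul_of_nonneg_left (min_pairing_le_sum_truncated hL (F_nonneg hU (hpos t)) hz0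
      hzL) (hα t)
    linarith
  have hone : ∀ t, 1 ≤ pairing (M.F (allocation (M.bids α b₀ t))) z := fun t =>
    (hz.isMintySolution hU hmono).2 _ (allocation_mem_feasible (hb t)) (hpos t)
  refine tendsto_zero_of_drift (C := 2 * (L + R) ^ 2 * Fintype.card K)
    (fun t => divergence_nonneg hz0 (hpos t) (hsum t)) hα hα_lim hα_sum ?_ fun η hη => ?_
  · filter_upwards [hstep] with t ht
    have := mul_nonneg (hα t) (sub_nonneg.2 (le_min (hone t) one_le_two))
    linarith
  · obtain ⟨δ, hδ, hdiv⟩ := exists_divergence_lt (z := z) hη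
    obtain ⟨c, hc, hgap⟩ := hz.exists_gap hU hcont hmono hδ
    -- The truncation at 2 caps the guaranteed drift at 2 - 1 = 1.
    refine ⟨min c 1, lt_min hc one_pos, ?_⟩
    filter_upwards [hstep] with t ht hE
    have hfar : δ ≤ dist (allocation (M.bids α b₀ t)) z := by
      by_contra! h
      exact absurd (hdiv _ h) (not_lt.2 hE)
    have h1 := hgap _ (allocation_mem_domF hU (hb t)) hfar
    have h2 : min c 1 ≤ min (pairing (M.F (allocation (M.bids α b₀ t))) z) 2 - 1 := by
      have h3 := min_le_left c 1
      have h4 := min_le_right c 1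
      have : 1 + min c 1 ≤ min (pairing (M.F (allocation (M.bids α b₀ t))) z) 2 :=
        le_min (by linarith) (by linarith)
      linarith
    have := mul_le_mul_of_nonneg_right h2 (hα t)
    linarith

end FisherMarket

theorem theorem5 {N K : Type*} [Fintype N] [Fintype K] [DecidableEq N] [DecidableEq K]
    (M : FisherMarket N K) (hU : M.RegularUtilities)
    (hcont : M.ContinuousF) (hmono : M.StrictlyMonotoneF)
    (α : ℕ → ℝ) (hα_nonneg : ∀ t, 0 ≤ α t)
    (hα_lim : Filter.Tendsto α Filter.atTop (nhds 0))
    (hα_sum : Filter.Tendsto (fun T => ∑ t ∈ Finset.range T, α t) Filter.atTop Filter.atTop) :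
    ∃ xstar : N → K → ℝ,
      M.IsVariationalEquilibrium xstar ∧
      (∀ y, M.IsVariationalEquilibrium y → y = xstar) ∧
      (∀ b₀ : N → K → ℝ, (∀ t, FisherMarket.IsPositive (M.bids α b₀ t)) →
        Filter.Tendsto (fun t => FisherMarket.allocation (M.bids α b₀ t)) Filter.atTop
          (nhds xstar)) ∧
      (∀ b₀ : N → K → ℝ, FisherMarket.IsPositive b₀ →
        (∀ t k, α t * max 1 (FisherMarket.price b₀ k) < 1) →
        ∀ t, FisherMarket.IsPositive (M.bids α b₀ t)) := by
  obtain ⟨x, hx⟩ := FisherMarket.exists_isMintySolution hU hmono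
  have hx := hx.isVariationalEquilibrium hU hcont
  exact ⟨x, hx, fun y hy => hx.unique hmono hy,
    fun b₀ hb => FisherMarket.tendsto_allocation_bids hU hcont hmono hα_nonneg hα_lim hα_sum hx hb,
    fun b₀ hb₀ hsmall t => (FisherMarket.isPositive_bids hU hα_nonneg hb₀ hsmall t).1⟩
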